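/- Let $n\ge 1$, let $\Omega\subset\mathbb R^n$ be a bounded domain (nonempty, open, connected) with $C^2$ boundary, and let $M\in C^2([0,+\infty))$ be real-valued. For $y_0\in L^2(\Omega)$ let $y(\cdot;y_0)\in C([0,+\infty);L^2(\Omega))$ denote the (weak) solution of the heat equation with memory $$\partial_t y-\Delta y+\int_0^t M(t-s)\,y(s,x)\,ds=0 \ \text{ in } (0,\infty)\times\Omega,\qquad y=0\ \text{ on } (0,\infty)\times\partial\Omega,\qquad y(0,\cdot)=y_0 .$$ Let $\lambda_1,\lambda_2,\dots$ be the eigenvalues of $-\Delta$ on $L^2(\Omega)$ with homogeneous Dirichlet boundary condition, and for each $k$ let $x_k$ be the solution on $[0,\infty)$ of $$x'(t)+\lambda_k x(t)+\int_0^t M(t-s)\,x(s)\,ds=0\quad (t>0),\qquad x(0)=1 .$$ For $t_0>0$, the equation is said to have backward uniqueness at $\{t_0\}$ if for every $y_0\in L^2(\Omega)$, $y(t_0;y_0)=0$ implies $y_0=0$. Then the following statements are equivalent: (i) for every $t_0>0$ the equation has backward uniqueness at $\{t_0\}$; (ii) for every $k\ge1$ the set $\mathcal N_k=\{t>0: x_k(t)=0\}$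 is empty. -/

import Mathlib

open MeasureTheory Filter Topology Laplacian
open scoped ContDiff

noncomputable section

namespace MemoryHeat

/-- The real Hilbert space `L²(Ω)` of an open set `Ω ⊆ ℝⁿ`, with Lebesgue measure. -/
abbrev L2 {n : ℕ} (Ω : Set (EuclideanSpace ℝ (Fin n))) : Type :=
  Lp ℝ 2 (volume.restrict Ω)

/-- `Ω` has a `C²` boundary: near each boundary point, `Ω` is the set where a `C²` function
with non-vanishing differential at that point is negative. Equivalently (implicit function
theorem), `Ω` is locally the region on one side of the graph of a `C²` function. -/
def HasC2Boundary {n : ℕ} (Ω : Set (EuclideanSpace ℝ (Fin n))) : Prop :=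
  ∀ p ∈ frontier Ω, ∃ r > 0, ∃ ψ : EuclideanSpace ℝ (Fin n) → ℝ,
    ContDiffOn ℝ 2 ψ (Metric.ball p r) ∧ fderiv ℝ ψ p ≠ 0 ∧
    ∀ x ∈ Metric.ball p r, x ∈ Ω ↔ ψ x < 0

/-- `φ ∈ C_c^∞(Ω)`. -/
structure IsTestFunction {n : ℕ} (Ω : Set (EuclideanSpace ℝ (Fin n)))
    (φ : EuclideanSpace ℝ (Fin n) → ℝ) : Prop where
  contDiff : ContDiff ℝ ∞ φ
  hasCompactSupport : HasCompactSupport φ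
  tsupport_subset : tsupport φ ⊆ Ω

/-- `u ∈ H₀¹(Ω)`, the closure of `C_c^∞(Ω)` in `H¹(Ω)`: there are test functions `φ j` converging
to `u` in `L²(Ω)` whose partial derivatives converge in `L²(Ω)`. The limits `g i` are then the weak
partial derivatives of `u`, so that the convergence takes place in `H¹(Ω)`. -/
def MemH10 {n : ℕ} (Ω : Set (EuclideanSpace ℝ (Fin n))) (u : L2 Ω) : Prop :=
  ∃ (g : Fin n → L2 Ω) (φ : ℕ → EuclideanSpace ℝ (Fin n) → ℝ),
    (∀ j, IsTestFunction Ω (φ j)) ∧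
    Tendsto (fun j => eLpNorm (fun x => φ j x - u x) 2 (volume.restrict Ω)) atTop (𝓝 0) ∧
    ∀ i, Tendsto
      (fun j => eLpNorm (fun x => fderiv ℝ (φ j) x (EuclideanSpace.single i 1) - g i x) 2
        (volume.restrict Ω)) atTop (𝓝 0)

/-- The graph of the Dirichlet Laplacian `A` on `L²(Ω)`: `u ∈ D(A)` and `A u = f`, that is,
`u ∈ H₀¹(Ω)` and the distributional Laplacian of `u` on `Ω` is the function `f ∈ L²(Ω)`.
When `Ω` is bounded with `C²` boundary, `D(A) = H²(Ω) ∩ H₀¹(Ω)` by elliptic regularity. -/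
def IsDirichletLaplacian {n : ℕ} (Ω : Set (EuclideanSpace ℝ (Fin n))) (u f : L2 Ω) : Prop :=
  MemH10 Ω u ∧ ∀ φ : EuclideanSpace ℝ (Fin n) → ℝ, IsTestFunction Ω φ →
    ∫ x in Ω, u x * Δ φ x = ∫ x in Ω, f x * φ x

/-- The set `{λ₁, λ₂, …}` of eigenvalues of `-A`. -/
def dirichletEigenvalues {n : ℕ} (Ω : Set (EuclideanSpace ℝ (Fin n))) : Set ℝ :=
  {μ | ∃ e : L2 Ω, e ≠ 0 ∧ IsDirichletLaplacian Ω e (-(μ • e))}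

/-- `y ∈ C([0,∞); L²(Ω))` is the (weak) solution of
`∂ₜ y - Δ y + ∫₀ᵗ M(t-s) y(s) ds = 0` on `(0,∞) × Ω`, `y = 0` on `(0,∞) × ∂Ω`, `y(0) = y₀`:
the equation holds for `t > 0` after pairing in `L²(Ω)` with any `v` in the domain of the
(self-adjoint) Dirichlet Laplacian `A`. -/
structure IsSolution {n : ℕ} (Ω : Set (EuclideanSpace ℝ (Fin n))) (M : ℝ → ℝ)
    (y₀ : L2 Ω) (y : ℝ → L2 Ω) : Prop where
  continuousOn : ContinuousOn y (Set.Ici 0)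
  initial : y 0 = y₀
  equation : ∀ v f : L2 Ω, IsDirichletLaplacian Ω v f → ∀ t : ℝ, 0 < t →
    HasDerivAt (fun τ => inner ℝ (y τ) v)
      (inner ℝ (y t) f - inner ℝ (∫ s in (0 : ℝ)..t, M (t - s) • y s) v) t

/-- Backward uniqueness at the finite set of times `T`: if the solution with initial datum
`y₀ ∈ L²(Ω)` vanishes at all the times in `T`, then `y₀ = 0`. -/
def BackwardUniquenessAt {n : ℕ} (Ω : Set (EuclideanSpace ℝ (Fin n))) (M : ℝ → ℝ)
    (T : Finset ℝ) : Prop :=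
  ∀ (y₀ : L2 Ω) (y : ℝ → L2 Ω), IsSolution Ω M y₀ y → (∀ t ∈ T, y t = 0) → y₀ = 0

/-- `x` is the solution on `[0,∞)` of `x' + μ x + ∫₀ᵗ M(t-s) x(s) ds = 0`, `x(0) = 1`. -/
structure IsScalarSolution (M : ℝ → ℝ) (μ : ℝ) (x : ℝ → ℝ) : Prop where
  continuousOn : ContinuousOn x (Set.Ici 0)
  initial : x 0 = 1
  equation : ∀ t : ℝ, 0 < t →
    HasDerivAt x (-(μ * x t) - ∫ s in (0 : ℝ)..t, M (t - s) * x s) t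

end MemoryHeat

end

/-!
The Dirichlet eigenfunctions decouple the equation. If `A e = -μ e`, then the coefficient
`a(t) = ⟨y(t), e⟩` of a solution satisfies the scalar equation with parameter `μ`, and conversely
`x(t) e` solves the heat equation with memory when `x` solves the scalar one
(`IsSolution.isScalarSolution_inner_div`, `IsScalarSolution.isSolution_smul`; the second uses the
symmetry of `A`, `IsDirichletLaplacian.inner_comm`).

A positive zero `t₀` of a scalar solution `x` thus produces the nonzero datum `e` whose solution
`x(t) e` vanishes at `t₀`. Conversely, let `y(t₀) = 0`. If `⟨y₀, e⟩ ≠ 0` for an eigenfunction `e`,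
then `⟨y(t), e⟩ / ⟨y₀, e⟩` is a scalar solution which vanishes at `t₀`; no existence or uniqueness
theorem for the scalar equation is needed. If there are no such zeros, `y₀` is therefore orthogonal
to all eigenfunctions, and it is zero because they span a dense subspace of `L²(Ω)`
(`eq_zero_of_forall_inner_eigenfunction_eq_zero`).

For the completeness of the eigenfunctions, `H₀¹(Ω)` is realized as the closure `H10 Ω` of the pairs
`(φ, ∇φ)`, `φ` a test function, in a power of `L²(Ω)`. If `J : H10 Ω → L²(Ω)` is the first
coordinate, then `J J†` is the operator `(1 - A)⁻¹`: by definition of the adjoint, `u = J† f`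
satisfies `⟨u, w⟩_{H¹} = ⟨f, J w⟩` for all `w`, which is the weak form of `u - Δ u = f`. It is
symmetric and injective, and its eigenvectors are the Dirichlet eigenfunctions, so that the spectral
theorem for compact self-adjoint operators applies once `J` is known to be compact.

Compactness of `J` (Rellich) is derived from an inequality
`‖J w‖² ≤ ∑ₖ ⟨aₖ, J w⟩² + ε ‖w‖²` with finitely many `aₖ ∈ L²(Ω)`, for every `ε > 0`
(`isCompactOperator_of_forall_norm_sq_le`, `exists_norm_sq_le_sum_inner_sq`). The `aₖ` are multiples
of the indicators of balls of a small radius `h` covering `Ω`: on such a ball, a test function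
differs from its mean by its increments over distances less than `2 h`, and these are controlled in
`L²` by the gradient (`lintegral_sq_translate_sub_le`).
-/

namespace MemoryHeat

/-! ### A compactness criterion in Hilbert space -/

/-- An operator which is small, up to finitely many functionals of its values, is compact: on the
orthogonal complement of the finite-dimensional span of the vectors `J† (w k)` its norm is at most
`√ε`, so that it is a limit of finite-rank operators. -/
theorem isCompactOperator_of_forall_norm_sq_le {α V H : Type*}
    [NormedAddCommGroup V] [InnerProductSpace ℝ V] [CompleteSpace V]
    [NormedAddCommGroup H] [InnerProductSpace ℝ H] [CompleteSpace H] (J : V →L[ℝ] H)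
    (h : ∀ ε > 0, ∃ (s : Finset α) (w : α → H), ∀ v : V,
      ‖J v‖ ^ 2 ≤ ∑ k ∈ s, inner ℝ (w k) (J v) ^ 2 + ε * ‖v‖ ^ 2) :
    IsCompactOperator J := by
  have hmem : J ∈ closure {f : V →L[ℝ] H | IsCompactOperator f} := by
    rw [Metric.mem_closure_iff]
    intro δ hδ
    obtain ⟨s, w, hw⟩ := h ((δ / 2) ^ 2) (by positivity)
    let S : Submodule ℝ V := Submodule.span ℝ ((fun k => J.adjoint (w k)) '' (s : Set α))
    have : FiniteDimensional ℝ S :=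
      FiniteDimensional.span_of_finite ℝ (s.finite_toSet.image _)
    -- The finite-rank approximation is `J` composed with the orthogonal projection onto `S`.
    refine ⟨J ∘L S.subtypeL ∘L S.orthogonalProjectionOnto, ?_, ?_⟩
    · have : ProperSpace S := FiniteDimensional.proper ℝ S
      exact (isCompactOperator_of_locallyCompactSpace_dom S.orthogonalProjectionOnto).clm_comp
        (J ∘L S.subtypeL)
    · rw [dist_eq_norm]
      refine lt_of_le_of_lt ?_ (half_lt_self hδ)
      refine ContinuousLinearMap.opNorm_le_bound _ (by positivity) fun v => ?_
      have hv := S.sub_starProjection_mem_orthogonal v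
      set u := v - S.starProjection v with hu
      have h0 : ∀ k ∈ s, inner ℝ (w k) (J u) = 0 := fun k hk => by
        rw [← ContinuousLinearMap.adjoint_inner_left]
        exact hv _ (Submodule.subset_span ⟨k, hk, rfl⟩)
      have h1 := hw u
      rw [Finset.sum_eq_zero (fun k hk => by rw [h0 k hk]; norm_num), zero_add, ← mul_pow] at h1
      have h2 := (pow_le_pow_iff_left₀ (norm_nonneg _) (by positivity) two_ne_zero).1 h1
      have h3 : ‖u‖ ≤ ‖v‖ := by
        rw [hu, ← Submodule.starProjection_orthogonal_val]
        exact Submodule.norm_starProjection_apply_le _ v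
      have h4 : (J - J ∘L S.subtypeL ∘L S.orthogonalProjectionOnto) v = J u := by
        rw [hu, map_sub]
        rfl
      rw [h4]
      exact h2.trans (by gcongr)
  rwa [isClosed_setOfPred_isCompactOperator.closure_eq] at hmem

/-! ### Increments, means and gradients -/

theorem sq_setAverage_le {α : Type*} [MeasurableSpace α] {μ : Measure α} {t : Set α} {f : α → ℝ}
    (h0 : μ t ≠ 0) (ht : μ t ≠ ⊤) (hf : IntegrableOn f t μ)
    (hf2 : IntegrableOn (fun x => f x ^ 2) t μ) :
    (⨍ x in t, f x ∂μ) ^ 2 ≤ ⨍ x in t, f x ^ 2 ∂μ :=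
  (even_two.convexOn_pow (𝕜 := ℝ)).map_set_average_le (by fun_prop) isClosed_univ h0 ht
    (by simp) hf hf2

section
variable {E : Type*} [NormedAddCommGroup E] [NormedSpace ℝ E]

theorem sq_sub_le_integral_sq_fderiv {φ : E → ℝ} (hφ : ContDiff ℝ 1 φ) (x z : E) :
    (φ (x + z) - φ x) ^ 2 ≤ ∫ t in Set.Ioc (0 : ℝ) 1, fderiv ℝ φ (x + t • z) z ^ 2 := by
  have hc : Continuous fun t : ℝ => fderiv ℝ φ (x + t • z) z := by
    have := hφ.continuous_fderiv one_ne_zero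
    fun_prop
  have h1 : ∫ t in Set.Ioc (0 : ℝ) 1, fderiv ℝ φ (x + t • z) z = φ (x + z) - φ x := by
    rw [← intervalIntegral.integral_of_le zero_le_one]
    have := intervalIntegral.integral_eq_sub_of_hasDerivAt (a := 0) (b := 1)
      (f := fun t : ℝ => φ (x + t • z)) (f' := fun t : ℝ => fderiv ℝ φ (x + t • z) z)
      (fun t _ => by
        have hd := (hφ.differentiable one_ne_zero (x + t • z)).hasFDerivAt
        have hl : HasDerivAt (fun t : ℝ => x + t • z) z t := by
          simpa using ((hasDerivAt_id t).smul_const z).const_add x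
        exact hd.comp_hasDerivAt t hl)
      (hc.intervalIntegrable _ _)
    simpa using this
  have h := sq_setAverage_le (μ := volume) (t := Set.Ioc (0 : ℝ) 1) (by simp) (by simp)
    (hc.integrableOn_Ioc) ((hc.pow 2).integrableOn_Ioc)
  simpa [setAverage_eq, h1] using h

variable [MeasurableSpace E] [BorelSpace E]

theorem lintegral_sq_translate_sub_le [SecondCountableTopology E]
    {μ : Measure E} [SFinite μ] [μ.IsAddRightInvariant]
    {φ : E → ℝ} (hφ : ContDiff ℝ 1 φ) (z : E) :
    ∫⁻ x, ENNReal.ofReal ((φ (x + z) - φ x) ^ 2) ∂μ ≤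
      ∫⁻ x, ENNReal.ofReal (fderiv ℝ φ x z ^ 2) ∂μ := by
  have hcd := hφ.continuous_fderiv one_ne_zero
  calc ∫⁻ x, ENNReal.ofReal ((φ (x + z) - φ x) ^ 2) ∂μ
      ≤ ∫⁻ x, (∫⁻ t in Set.Ioc (0 : ℝ) 1, ENNReal.ofReal (fderiv ℝ φ (x + t • z) z ^ 2)) ∂μ := by
        refine lintegral_mono fun x => ?_
        have hc : Continuous fun t : ℝ => fderiv ℝ φ (x + t • z) z ^ 2 := by fun_prop
        rw [← ofReal_integral_eq_lintegral_ofReal hc.integrableOn_Ioc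
          (ae_of_all _ fun t => sq_nonneg _)]
        exact ENNReal.ofReal_le_ofReal (sq_sub_le_integral_sq_fderiv hφ x z)
    _ = ∫⁻ t in Set.Ioc (0 : ℝ) 1, ∫⁻ x, ENNReal.ofReal (fderiv ℝ φ (x + t • z) z ^ 2) ∂μ := by
        refine lintegral_lintegral_swap (Measurable.aemeasurable ?_)
        have hc : Continuous fun p : E × ℝ => fderiv ℝ φ (p.1 + p.2 • z) z ^ 2 := by fun_prop
        exact (ENNReal.continuous_ofReal.comp hc).measurable
    _ = ∫⁻ t in Set.Ioc (0 : ℝ) 1, ∫⁻ x, ENNReal.ofReal (fderiv ℝ φ x z ^ 2) ∂μ := by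
        congr 1 with t
        exact lintegral_add_right_eq_self (fun x => ENNReal.ofReal (fderiv ℝ φ x z ^ 2)) (t • z)
    _ = _ := by simp
end

/-- The value at a point of a ball is the mean over the ball up to the increments based at this
point. The ball is enlarged to one centred at `x`, so that the error does not depend on `c`. -/
theorem sq_le_setAverage_ball {E : Type*} [NormedAddCommGroup E] [ProperSpace E]
    [MeasurableSpace E] [BorelSpace E] {μ : Measure E} [μ.IsAddHaarMeasure]
    {φ : E → ℝ} (hφ : Continuous φ) {h : ℝ} (hh : 0 < h) {x c : E} (hx : x ∈ Metric.ball c h) :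
    φ x ^ 2 ≤ 2 * (⨍ y in Metric.ball c h, φ y ∂μ) ^ 2 +
      2 * (μ.real (Metric.ball 0 h))⁻¹ *
        ∫ z in Metric.ball 0 (2 * h), (φ (x + z) - φ x) ^ 2 ∂μ := by
  have hball : ∀ {ψ : E → ℝ}, Continuous ψ → ∀ (c : E) (r : ℝ),
      IntegrableOn ψ (Metric.ball c r) μ :=
    fun hψ c r => (hψ.continuousOn.integrableOn_compact (isCompact_closedBall c r)).mono_set
      Metric.ball_subset_closedBall
  have h0 : μ (Metric.ball c h) ≠ 0 := (Metric.measure_ball_pos μ c hh).ne'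
  have ht : μ (Metric.ball c h) ≠ ⊤ := measure_ball_lt_top.ne
  have hvol : μ.real (Metric.ball c h) = μ.real (Metric.ball 0 h) := by
    simp only [Measure.real, Measure.addHaar_ball_center]
  have hpos : 0 < μ.real (Metric.ball c h) := ENNReal.toReal_pos h0 ht
  set m := ⨍ y in Metric.ball c h, φ y ∂μ with hm
  have h1 : ⨍ y in Metric.ball c h, (φ y - φ x) ∂μ = m - φ x := by
    rw [hm, setAverage_eq, setAverage_eq, integral_sub (hball hφ c h) (hball continuous_const c h)]
    simp only [integral_const, smul_eq_mul, measureReal_restrict_apply_univ]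
    field_simp
  have h2 := sq_setAverage_le (f := fun y => φ y - φ x) h0 ht (hball (hφ.sub continuous_const) c h)
    (hball ((hφ.sub (continuous_const (y := φ x))).pow 2) c h)
  rw [h1, setAverage_eq, smul_eq_mul, hvol] at h2
  have h3 : ∫ y in Metric.ball c h, (φ y - φ x) ^ 2 ∂μ ≤
      ∫ z in Metric.ball 0 (2 * h), (φ (x + z) - φ x) ^ 2 ∂μ := by
    have hset : (fun z => x + z) ⁻¹' Metric.ball x (2 * h) = Metric.ball 0 (2 * h) := by
      ext z; simp
    rw [← hset, (measurePreserving_add_left μ x).setIntegral_preimage_emb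
      (measurableEmbedding_addLeft x) (fun y => (φ y - φ x) ^ 2)]
    refine setIntegral_mono_set (hball (by fun_prop) _ _) (ae_of_all _ fun y => sq_nonneg _)
      (LE.le.eventuallyLE (Metric.ball_subset_ball' ?_))
    rw [Metric.mem_ball, dist_comm] at hx
    linarith
  have h4 : (μ.real (Metric.ball 0 h))⁻¹ * ∫ y in Metric.ball c h, (φ y - φ x) ^ 2 ∂μ ≤
      (μ.real (Metric.ball 0 h))⁻¹ * ∫ z in Metric.ball 0 (2 * h), (φ (x + z) - φ x) ^ 2 ∂μ := by
    gcongr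
  -- `φ x ^ 2 ≤ 2 * m ^ 2 + 2 * (m - φ x) ^ 2` is `0 ≤ (2 * m - φ x) ^ 2`.
  nlinarith [sq_nonneg (2 * m - φ x)]

/-! ### Test functions -/

section
variable {n : ℕ} {Ω : Set (EuclideanSpace ℝ (Fin n))}

namespace IsTestFunction
variable {φ ψ : EuclideanSpace ℝ (Fin n) → ℝ}

theorem continuous (hφ : IsTestFunction Ω φ) : Continuous φ := hφ.contDiff.continuous

theorem memLp (hφ : IsTestFunction Ω φ) {p : ENNReal}
    {μ : Measure (EuclideanSpace ℝ (Fin n))} [IsFiniteMeasureOnCompacts μ] : MemLp φ p μ :=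
  hφ.continuous.memLp_of_hasCompactSupport hφ.hasCompactSupport

theorem eq_zero_of_notMem (hφ : IsTestFunction Ω φ) {x : EuclideanSpace ℝ (Fin n)} (hx : x ∉ Ω) :
    φ x = 0 :=
  image_eq_zero_of_notMem_tsupport fun h => hx (hφ.tsupport_subset h)

theorem add (hφ : IsTestFunction Ω φ) (hψ : IsTestFunction Ω ψ) : IsTestFunction Ω (φ + ψ) :=
  ⟨hφ.contDiff.add hψ.contDiff, hφ.hasCompactSupport.add hψ.hasCompactSupport,
    (tsupport_add φ ψ).trans (Set.union_subset hφ.tsupport_subset hψ.tsupport_subset)⟩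

theorem const_smul (hφ : IsTestFunction Ω φ) (c : ℝ) : IsTestFunction Ω (c • φ) :=
  ⟨hφ.contDiff.const_smul c, hφ.hasCompactSupport.mono (Function.support_const_smul_subset c φ),
    (closure_mono (Function.support_const_smul_subset c φ)).trans hφ.tsupport_subset⟩

theorem zero : IsTestFunction Ω (0 : EuclideanSpace ℝ (Fin n) → ℝ) :=
  ⟨contDiff_const, HasCompactSupport.zero, by simp [tsupport]⟩

theorem fderiv_apply (hφ : IsTestFunction Ω φ) (v : EuclideanSpace ℝ (Fin n)) :
    IsTestFunction Ω (fun x => fderiv ℝ φ x v) :=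
  ⟨((contDiff_infty_iff_fderiv.1 hφ.contDiff).2).clm_apply contDiff_const,
    hφ.hasCompactSupport.fderiv_apply (𝕜 := ℝ) v,
    (tsupport_fderiv_apply_subset ℝ v).trans hφ.tsupport_subset⟩

theorem laplacian_eq (hφ : IsTestFunction Ω φ) :
    Δ φ = fun x => ∑ i, fderiv ℝ (fun y => fderiv ℝ φ y (EuclideanSpace.single i 1)) x
      (EuclideanSpace.single i 1) := by
  rw [InnerProductSpace.laplacian_eq_iteratedFDeriv_orthonormalBasis φ
    (EuclideanSpace.basisFun (Fin n) ℝ)]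
  ext x
  refine Finset.sum_congr rfl fun i _ => ?_
  have hd : DifferentiableAt ℝ (fderiv ℝ φ) x :=
    ((contDiff_infty_iff_fderiv.1 hφ.contDiff).2).differentiable (by simp) x
  rw [iteratedFDeriv_two_apply, fderiv_clm_apply hd (differentiableAt_const _)]
  simp

theorem setIntegral_mul_eq (hφ : IsTestFunction Ω φ) (f : EuclideanSpace ℝ (Fin n) → ℝ) :
    ∫ x in Ω, f x * φ x = ∫ x, f x * φ x :=
  setIntegral_eq_integral_of_forall_compl_eq_zero fun x hx => by
    rw [hφ.eq_zero_of_notMem hx, mul_zero]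

theorem integrable_mul (hφ : IsTestFunction Ω φ) (hψ : IsTestFunction Ω ψ)
    {μ : Measure (EuclideanSpace ℝ (Fin n))} [IsFiniteMeasureOnCompacts μ] :
    Integrable (fun x => φ x * ψ x) μ :=
  MemLp.integrable_mul (p := 2) (q := 2) hφ.memLp hψ.memLp

theorem setIntegral_mul_laplacian (hφ : IsTestFunction Ω φ) (hψ : IsTestFunction Ω ψ) :
    ∫ x in Ω, ψ x * Δ φ x = -∑ i, ∫ x in Ω,
      fderiv ℝ ψ x (EuclideanSpace.single i 1) * fderiv ℝ φ x (EuclideanSpace.single i 1) := by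
  rw [hφ.laplacian_eq]
  simp only [Finset.mul_sum]
  rw [integral_finsetSum _ fun i _ => hψ.integrable_mul ((hφ.fderiv_apply _).fderiv_apply _),
    ← Finset.sum_neg_distrib]
  refine Finset.sum_congr rfl fun i _ => ?_
  have h1 := hφ.fderiv_apply (EuclideanSpace.single i 1)
  rw [(h1.fderiv_apply _).setIntegral_mul_eq, h1.setIntegral_mul_eq]
  exact integral_mul_fderiv_eq_neg_fderiv_mul_of_integrable
    ((hψ.fderiv_apply _).integrable_mul h1) (hψ.integrable_mul (h1.fderiv_apply _))
    (hψ.integrable_mul h1) (fun x _ => hψ.contDiff.differentiable (by simp) x)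
    (fun x _ => h1.contDiff.differentiable (by simp) x)

end IsTestFunction

theorem sq_fderiv_apply_le (φ : EuclideanSpace ℝ (Fin n) → ℝ) (x z : EuclideanSpace ℝ (Fin n)) :
    fderiv ℝ φ x z ^ 2 ≤
      ‖z‖ ^ 2 * ∑ i, fderiv ℝ φ x (EuclideanSpace.single i 1) ^ 2 := by
  have hz : fderiv ℝ φ x z = ∑ i, z i * fderiv ℝ φ x (EuclideanSpace.single i 1) := by
    conv_lhs => rw [← (EuclideanSpace.basisFun (Fin n) ℝ).sum_repr z]
    simp [map_sum]
  rw [hz, EuclideanSpace.real_norm_sq_eq]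
  exact Finset.sum_mul_sq_le_sq_mul_sq _ _ _

/-- A quantitative form of Rellich's theorem. Every point of `Ω` lies in one of the balls, and the
square of the mean over that ball is bounded by the sum over all of them, so that no partition of
`Ω` is needed. The factor `2 ^ (n + 3)` is `2 * 2 ^ 2` times the ratio `2 ^ n` of the volumes of the
balls of radii `2 * h` and `h`. -/
theorem IsTestFunction.setIntegral_sq_le {φ : EuclideanSpace ℝ (Fin n) → ℝ}
    (hφ : IsTestFunction Ω φ) (hΩm : MeasurableSet Ω) (hΩ : volume Ω ≠ ⊤) {h : ℝ} (hh : 0 < h)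
    {s : Finset (EuclideanSpace ℝ (Fin n))} (hs : Ω ⊆ ⋃ c ∈ s, Metric.ball c h) :
    ∫ x in Ω, φ x ^ 2 ≤
      2 * volume.real Ω * ∑ c ∈ s, (⨍ y in Metric.ball c h, φ y) ^ 2 +
      2 ^ (n + 3) * h ^ 2 * ∑ i, ∫ x in Ω, fderiv ℝ φ x (EuclideanSpace.single i 1) ^ 2 := by
  set m : EuclideanSpace ℝ (Fin n) → ℝ := fun c => ⨍ y in Metric.ball c h, φ y
  set b : ℝ := volume.real (Metric.ball (0 : EuclideanSpace ℝ (Fin n)) h) with hb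
  have hb0 : 0 < b := ENNReal.toReal_pos (Metric.measure_ball_pos _ _ hh).ne'
    measure_ball_lt_top.ne
  set G : EuclideanSpace ℝ (Fin n) → ℝ :=
    fun x => ∑ i, fderiv ℝ φ x (EuclideanSpace.single i 1) ^ 2 with hG
  have hD : ∀ i, IsTestFunction Ω fun x => fderiv ℝ φ x (EuclideanSpace.single i 1) :=
    fun i => hφ.fderiv_apply _
  have hGi : Integrable G := integrable_finsetSum _ fun i _ => (hD i).memLp.integrable_sq
  have hGint : ∫ x, G x = ∑ i, ∫ x in Ω, fderiv ℝ φ x (EuclideanSpace.single i 1) ^ 2 := by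
    rw [hG, integral_finsetSum _ fun i _ => (hD i).memLp.integrable_sq]
    refine Finset.sum_congr rfl fun i _ =>
      (setIntegral_eq_integral_of_forall_compl_eq_zero fun x hx => ?_).symm
    rw [(hD i).eq_zero_of_notMem hx]; norm_num
  have hG0 : ∀ x, 0 ≤ G x := fun x => Finset.sum_nonneg fun i _ => sq_nonneg _
  have hc := hφ.continuous
  have hpt : ∀ x ∈ Ω, ENNReal.ofReal (φ x ^ 2) ≤ ENNReal.ofReal (2 * ∑ c ∈ s, m c ^ 2) +
      ENNReal.ofReal (2 * b⁻¹) * ∫⁻ z in Metric.ball 0 (2 * h),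
        ENNReal.ofReal ((φ (x + z) - φ x) ^ 2) := by
    intro x hx
    obtain ⟨c, hcs, hxc⟩ : ∃ c ∈ s, x ∈ Metric.ball c h := by simpa using hs hx
    have hi : IntegrableOn (fun z => (φ (x + z) - φ x) ^ 2)
        (Metric.ball (0 : EuclideanSpace ℝ (Fin n)) (2 * h)) :=
      ((by fun_prop : Continuous fun z => (φ (x + z) - φ x) ^ 2).continuousOn.integrableOn_compact
        (isCompact_closedBall _ _)).mono_set Metric.ball_subset_closedBall
    rw [← ofReal_integral_eq_lintegral_ofReal hi (ae_of_all _ fun z => sq_nonneg _),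
      ← ENNReal.ofReal_mul (by positivity), ← ENNReal.ofReal_add
        (by have := Finset.sum_nonneg fun c (_ : c ∈ s) => sq_nonneg (m c); positivity)
        (mul_nonneg (by positivity) (integral_nonneg fun z => sq_nonneg _))]
    refine ENNReal.ofReal_le_ofReal ((sq_le_setAverage_ball (μ := volume) hc hh hxc).trans ?_)
    gcongr
    exact Finset.single_le_sum (f := fun c => m c ^ 2) (fun c _ => sq_nonneg _) hcs
  have htr : ∀ z ∈ Metric.ball (0 : EuclideanSpace ℝ (Fin n)) (2 * h),
      ∫⁻ x, ENNReal.ofReal ((φ (x + z) - φ x) ^ 2) ≤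
        ENNReal.ofReal ((2 * h) ^ 2 * ∫ x, G x) := by
    intro z hz
    refine (lintegral_sq_translate_sub_le (hφ.contDiff.of_le (by simp)) z).trans ?_
    rw [← integral_const_mul, ofReal_integral_eq_lintegral_ofReal (hGi.const_mul _)
      (ae_of_all _ fun x => mul_nonneg (sq_nonneg _) (hG0 x))]
    refine lintegral_mono fun x => ENNReal.ofReal_le_ofReal ((sq_fderiv_apply_le φ x z).trans ?_)
    have : ‖z‖ ≤ 2 * h := (mem_ball_zero_iff.1 hz).le
    have := hG0 x
    gcongr
  have hball : volume.real (Metric.ball (0 : EuclideanSpace ℝ (Fin n)) (2 * h)) = 2 ^ n * b := by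
    rw [hb, Measure.real, Measure.addHaar_ball_mul_of_pos _ _ two_pos, ENNReal.toReal_mul,
      finrank_euclideanSpace_fin, ENNReal.toReal_ofReal (by positivity), Measure.real]
  have hIG : 0 ≤ ∫ x, G x := integral_nonneg hG0
  have hS : 0 ≤ ∑ c ∈ s, m c ^ 2 := Finset.sum_nonneg fun c _ => sq_nonneg _
  -- Integrate `hpt` over `Ω`, exchange the integrals over `x` and `z`, and apply `htr` to each `z`.
  have hmain : ENNReal.ofReal (∫ x in Ω, φ x ^ 2) ≤
      ENNReal.ofReal (2 * ∑ c ∈ s, m c ^ 2) * ENNReal.ofReal (volume.real Ω) +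
      ENNReal.ofReal (2 * b⁻¹) * (ENNReal.ofReal ((2 * h) ^ 2 * ∫ x, G x) *
        ENNReal.ofReal (2 ^ n * b)) := by
    rw [ofReal_integral_eq_lintegral_ofReal hφ.memLp.integrable_sq
      (ae_of_all _ fun x => sq_nonneg _)]
    refine (setLIntegral_mono' hΩm hpt).trans ?_
    rw [lintegral_add_left measurable_const, setLIntegral_const,
      lintegral_const_mul' _ _ ENNReal.ofReal_ne_top, Measure.real, ENNReal.ofReal_toReal hΩ]
    gcongr
    calc ∫⁻ x in Ω, ∫⁻ z in Metric.ball 0 (2 * h), ENNReal.ofReal ((φ (x + z) - φ x) ^ 2)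
        ≤ ∫⁻ x, ∫⁻ z in Metric.ball 0 (2 * h), ENNReal.ofReal ((φ (x + z) - φ x) ^ 2) :=
          setLIntegral_le_lintegral _ _
      _ = ∫⁻ z in Metric.ball 0 (2 * h), ∫⁻ x, ENNReal.ofReal ((φ (x + z) - φ x) ^ 2) := by
          refine lintegral_lintegral_swap (Measurable.aemeasurable ?_)
          exact (ENNReal.continuous_ofReal.comp
            (by fun_prop : Continuous fun p : EuclideanSpace ℝ (Fin n) × _ =>
              (φ (p.1 + p.2) - φ p.1) ^ 2)).measurable
      _ ≤ ∫⁻ z in Metric.ball (0 : EuclideanSpace ℝ (Fin n)) (2 * h),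
            ENNReal.ofReal ((2 * h) ^ 2 * ∫ x, G x) :=
          setLIntegral_mono' measurableSet_ball htr
      _ = _ := by
          rw [setLIntegral_const, ← hball, Measure.real,
            ENNReal.ofReal_toReal measure_ball_lt_top.ne]
  have hv : 0 ≤ volume.real Ω := measureReal_nonneg
  rw [← ENNReal.ofReal_mul (by positivity), ← ENNReal.ofReal_mul (by positivity),
    ← ENNReal.ofReal_mul (by positivity), ← ENNReal.ofReal_add (by positivity) (by positivity),
    ENNReal.ofReal_le_ofReal_iff (by positivity)] at hmain
  rw [← hGint]
  refine hmain.trans (le_of_eq ?_)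
  field_simp
  ring

end

/-! ### The space `H₀¹(Ω)` -/

noncomputable section

variable {n : ℕ} {Ω : Set (EuclideanSpace ℝ (Fin n))}

/-- The Hilbert space `L²(Ω) × L²(Ω)ⁿ`: the coordinate `none` is for a function, the coordinates
`some i` for its partial derivatives. Its norm restricts to the `H¹` norm on pairs `(u, ∇u)`. -/
abbrev FunctionGradient {n : ℕ} (Ω : Set (EuclideanSpace ℝ (Fin n))) : Type :=
  PiLp 2 (fun _ : Option (Fin n) => L2 Ω)

/-- The subspace of the pairs `(φ, ∇φ)` with `φ` a test function on `Ω`. -/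
def testGraph {n : ℕ} (Ω : Set (EuclideanSpace ℝ (Fin n))) : Submodule ℝ (FunctionGradient Ω) where
  carrier := {w | ∃ φ, IsTestFunction Ω φ ∧ w none =ᵐ[volume.restrict Ω] φ ∧
    ∀ i, w (some i) =ᵐ[volume.restrict Ω] fun x => fderiv ℝ φ x (EuclideanSpace.single i 1)}
  add_mem' := by
    rintro v w ⟨φ, hφ, hv, hv'⟩ ⟨ψ, hψ, hw, hw'⟩
    refine ⟨φ + ψ, hφ.add hψ, (Lp.coeFn_add _ _).trans (hv.add hw), fun i => ?_⟩
    refine (Lp.coeFn_add _ _).trans (((hv' i).add (hw' i)).trans (ae_of_all _ fun x => ?_))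
    simp only [Pi.add_apply]
    rw [fderiv_add (hφ.contDiff.differentiable (by simp) x)
      (hψ.contDiff.differentiable (by simp) x)]
    rfl
  zero_mem' := ⟨0, IsTestFunction.zero, Lp.coeFn_zero _ _ _, fun i => by
    refine (Lp.coeFn_zero ℝ 2 (volume.restrict Ω)).trans (ae_of_all _ fun x => ?_)
    simp⟩
  smul_mem' := by
    rintro c v ⟨φ, hφ, hv, hv'⟩
    refine ⟨c • φ, hφ.const_smul c, (Lp.coeFn_smul _ _).trans (hv.const_smul c), fun i => ?_⟩
    refine (Lp.coeFn_smul _ _).trans (((hv' i).const_smul c).trans (ae_of_all _ fun x => ?_))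
    simp only [Pi.smul_apply]
    rw [fderiv_const_smul (hφ.contDiff.differentiable (by simp) x)]
    rfl

/-- `H₀¹(Ω)` as a Hilbert space: the pairs `(u, ∇u)` which are limits in `L²(Ω)` of pairs `(φ, ∇φ)`
with `φ` a test function. -/
def H10 {n : ℕ} (Ω : Set (EuclideanSpace ℝ (Fin n))) : Submodule ℝ (FunctionGradient Ω) :=
  (testGraph Ω).topologicalClosure

instance : CompleteSpace (H10 Ω) :=
  (Submodule.isClosed_topologicalClosure _).completeSpace_coe

/-- A closed condition holds on `H10 Ω` as soon as it holds for test functions. -/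
theorem H10_induction {p : FunctionGradient Ω → Prop} (hp : IsClosed {w | p w})
    (h : ∀ w ∈ testGraph Ω, p w) : ∀ w ∈ H10 Ω, p w := fun _ hw => closure_minimal h hp hw

/-- The embedding `(u, ∇u) ↦ u` of `H₀¹(Ω)` into `L²(Ω)`. -/
def H10.toL2 {n : ℕ} (Ω : Set (EuclideanSpace ℝ (Fin n))) : H10 Ω →L[ℝ] L2 Ω :=
  PiLp.proj 2 (fun _ : Option (Fin n) => L2 Ω) none ∘L (H10 Ω).subtypeL

theorem H10.toL2_apply (w : H10 Ω) : H10.toL2 Ω w = (w : FunctionGradient Ω) none := rfl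

/-- The pair `(φ, ∇φ)` of a test function. -/
def IsTestFunction.graph {φ : EuclideanSpace ℝ (Fin n) → ℝ} (hφ : IsTestFunction Ω φ) :
    FunctionGradient Ω :=
  WithLp.toLp 2 fun o => o.elim (hφ.memLp.toLp φ)
    fun i => (hφ.fderiv_apply (EuclideanSpace.single i 1)).memLp.toLp _

theorem IsTestFunction.graph_none {φ : EuclideanSpace ℝ (Fin n) → ℝ} (hφ : IsTestFunction Ω φ) :
    hφ.graph none =ᵐ[volume.restrict Ω] φ :=
  MemLp.coeFn_toLp hφ.memLp

theorem IsTestFunction.graph_some {φ : EuclideanSpace ℝ (Fin n) → ℝ} (hφ : IsTestFunction Ω φ)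
    (i : Fin n) : hφ.graph (some i) =ᵐ[volume.restrict Ω]
      fun x => fderiv ℝ φ x (EuclideanSpace.single i 1) :=
  MemLp.coeFn_toLp (hφ.fderiv_apply (EuclideanSpace.single i 1)).memLp

theorem IsTestFunction.graph_mem_testGraph {φ : EuclideanSpace ℝ (Fin n) → ℝ}
    (hφ : IsTestFunction Ω φ) : hφ.graph ∈ testGraph Ω :=
  ⟨φ, hφ, hφ.graph_none, hφ.graph_some⟩

theorem inner_eq_integral_mul (u v : L2 Ω) : inner ℝ u v = ∫ x in Ω, u x * v x := by
  rw [L2.inner_def]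
  exact integral_congr_ae (ae_of_all _ fun x => by simp [mul_comm])

theorem inner_eq_integral_mul_of_ae_eq (u : L2 Ω) {v : L2 Ω} {ψ : EuclideanSpace ℝ (Fin n) → ℝ}
    (h : v =ᵐ[volume.restrict Ω] ψ) : inner ℝ u v = ∫ x in Ω, u x * ψ x := by
  rw [inner_eq_integral_mul]
  exact integral_congr_ae (h.mono fun x hx => by simp only [hx])

theorem norm_sq_eq_of_ae_eq {v : L2 Ω} {ψ : EuclideanSpace ℝ (Fin n) → ℝ}
    (h : v =ᵐ[volume.restrict Ω] ψ) : ‖v‖ ^ 2 = ∫ x in Ω, ψ x ^ 2 := by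
  rw [← real_inner_self_eq_norm_sq, inner_eq_integral_mul]
  exact integral_congr_ae (h.mono fun x hx => by simp only [hx, sq])

theorem memH10_iff (u : L2 Ω) : MemH10 Ω u ↔ ∃ w ∈ H10 Ω, w none = u := by
  have key : ∀ (φ : ℕ → EuclideanSpace ℝ (Fin n) → ℝ) (f : ℕ → L2 Ω) (g : L2 Ω),
      (∀ j, f j =ᵐ[volume.restrict Ω] φ j) →
      (Tendsto (fun j => eLpNorm (fun x => φ j x - g x) 2 (volume.restrict Ω)) atTop (𝓝 0) ↔
        Tendsto f atTop (𝓝 g)) := by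
    intro φ f g hf
    rw [Lp.tendsto_Lp_iff_tendsto_eLpNorm']
    refine tendsto_congr fun j => eLpNorm_congr_ae ((hf j).mono fun x hx => ?_)
    simp [hx]
  constructor
  · rintro ⟨g, φ, hφ, h0, h1⟩
    refine ⟨WithLp.toLp 2 fun o => o.elim u g, ?_, rfl⟩
    refine mem_closure_of_tendsto (f := fun j => (hφ j).graph) (b := atTop) ?_
      (Eventually.of_forall fun j => (hφ j).graph_mem_testGraph)
    refine ((PiLp.continuous_toLp 2 _).tendsto _).comp (tendsto_pi_nhds.2 ?_)
    rintro (_ | i)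
    · exact (key φ _ u fun j => (hφ j).graph_none).1 h0
    · exact (key _ _ (g i) fun j => (hφ j).graph_some i).1 (h1 i)
  · rintro ⟨w, hw, rfl⟩
    obtain ⟨W, hW, hlim⟩ := mem_closure_iff_seq_limit.1 hw
    choose φ hφ h0 h1 using hW
    have hco : ∀ o, Tendsto (fun j => W j o) atTop (𝓝 (w o)) := fun o =>
      ((PiLp.proj (𝕜 := ℝ) 2 (fun _ : Option (Fin n) => L2 Ω) o).continuous.tendsto w).comp hlim
    exact ⟨fun i => w (some i), φ, hφ, (key φ _ _ h0).2 (hco none),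
      fun i => (key _ _ _ fun j => h1 j i).2 (hco (some i))⟩

/-! ### Weak derivatives and symmetry of the Dirichlet Laplacian -/

theorem IsTestFunction.memLp_laplacian {φ : EuclideanSpace ℝ (Fin n) → ℝ}
    (hφ : IsTestFunction Ω φ) : MemLp (Δ φ) 2 (volume.restrict Ω) := by
  rw [hφ.laplacian_eq]
  exact memLp_finsetSum _ fun i _ => ((hφ.fderiv_apply _).fderiv_apply _).memLp

/-- The coordinates `w (some i)` of an element of `H10 Ω` are the weak partial derivatives of
`w none`, tested against the second derivatives of a test function. -/
theorem integral_mul_laplacian_of_mem_H10 {φ : EuclideanSpace ℝ (Fin n) → ℝ}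
    (hφ : IsTestFunction Ω φ) : ∀ w ∈ H10 Ω,
    ∫ x in Ω, w none x * Δ φ x = -∑ i, ∫ x in Ω,
      w (some i) x * fderiv ℝ φ x (EuclideanSpace.single i 1) := by
  have h0 : ∀ u : L2 Ω, ∫ x in Ω, u x * Δ φ x = inner ℝ u (hφ.memLp_laplacian.toLp _) :=
    fun u => (inner_eq_integral_mul_of_ae_eq u (MemLp.coeFn_toLp _)).symm
  have h1 : ∀ (u : L2 Ω) (i : Fin n), ∫ x in Ω, u x * fderiv ℝ φ x (EuclideanSpace.single i 1) =
      inner ℝ u ((hφ.fderiv_apply (EuclideanSpace.single i 1)).memLp.toLp _) :=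
    fun u i => (inner_eq_integral_mul_of_ae_eq u (MemLp.coeFn_toLp _)).symm
  refine H10_induction ?_ ?_
  · simp only [h0, h1]
    exact isClosed_eq (by fun_prop) (by fun_prop)
  · rintro w ⟨ψ, hψ, hw, hw'⟩
    have e0 : ∫ x in Ω, w none x * Δ φ x = ∫ x in Ω, ψ x * Δ φ x :=
      integral_congr_ae (hw.mono fun x hx => by simp only [hx])
    rw [e0, hφ.setIntegral_mul_laplacian hψ]
    congr 1
    refine Finset.sum_congr rfl fun i _ => ?_
    exact integral_congr_ae ((hw' i).mono fun x hx => by simp only [hx])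

/-- The weak form of `Δ u = f`, extended from test functions to `H₀¹(Ω)`. -/
theorem inner_eq_neg_sum_inner_grad {u f : L2 Ω} (h : IsDirichletLaplacian Ω u f)
    {v : FunctionGradient Ω} (hv : v ∈ H10 Ω) (hvu : v none = u) : ∀ w ∈ H10 Ω,
    inner ℝ f (w none) = -∑ i, inner ℝ (v (some i)) (w (some i)) := by
  refine H10_induction (isClosed_eq (by fun_prop) (by fun_prop)) ?_
  rintro w ⟨φ, hφ, hw, hw'⟩
  rw [inner_eq_integral_mul_of_ae_eq f hw, ← h.2 φ hφ, ← hvu,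
    integral_mul_laplacian_of_mem_H10 hφ v hv]
  simp only [inner_eq_integral_mul_of_ae_eq _ (hw' _)]

/-- The Dirichlet Laplacian is symmetric. -/
theorem IsDirichletLaplacian.inner_comm {u f v g : L2 Ω} (hu : IsDirichletLaplacian Ω u f)
    (hv : IsDirichletLaplacian Ω v g) : inner ℝ f v = inner ℝ u g := by
  obtain ⟨U, hU, rfl⟩ := (memH10_iff u).1 hu.1
  obtain ⟨V, hV, rfl⟩ := (memH10_iff v).1 hv.1
  rw [inner_eq_neg_sum_inner_grad hu hU rfl V hV, real_inner_comm,
    inner_eq_neg_sum_inner_grad hv hV rfl U hU]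
  simp only [real_inner_comm]

theorem MemH10.smul {u : L2 Ω} (h : MemH10 Ω u) (c : ℝ) : MemH10 Ω (c • u) := by
  obtain ⟨w, hw, rfl⟩ := (memH10_iff u).1 h
  exact (memH10_iff _).2 ⟨c • w, (H10 Ω).smul_mem c hw, rfl⟩

theorem IsDirichletLaplacian.smul {u f : L2 Ω} (h : IsDirichletLaplacian Ω u f) (c : ℝ) :
    IsDirichletLaplacian Ω (c • u) (c • f) := by
  refine ⟨h.1.smul c, fun φ hφ => ?_⟩
  have hc : ∀ (g : L2 Ω) (ψ : EuclideanSpace ℝ (Fin n) → ℝ),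
      ∫ x in Ω, (c • g : L2 Ω) x * ψ x = c * ∫ x in Ω, g x * ψ x := fun g ψ => by
    rw [← integral_const_mul]
    refine integral_congr_ae ((Lp.coeFn_smul c g).mono fun x hx => ?_)
    simp [hx, mul_assoc]
  rw [hc, hc, h.2 φ hφ]

/-! ### Compactness of the embedding and completeness of the eigenfunctions -/

theorem exists_norm_sq_le_sum_inner_sq (hΩo : IsOpen Ω) (hΩb : Bornology.IsBounded Ω) {ε : ℝ}
    (hε : 0 < ε) : ∃ (s : Finset (EuclideanSpace ℝ (Fin n))) (a : EuclideanSpace ℝ (Fin n) → L2 Ω),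
    ∀ w : H10 Ω, ‖H10.toL2 Ω w‖ ^ 2 ≤
      ∑ c ∈ s, inner ℝ (a c) (H10.toL2 Ω w) ^ 2 + ε * ‖w‖ ^ 2 := by
  have hvol : volume Ω ≠ ⊤ := hΩb.measure_lt_top.ne
  -- The radius for which the gradient term of `IsTestFunction.setIntegral_sq_le` has factor `ε`.
  obtain ⟨h, hh, hhε⟩ : ∃ h : ℝ, 0 < h ∧ 2 ^ (n + 3) * h ^ 2 = ε :=
    ⟨√(ε / 2 ^ (n + 3)), by positivity, by rw [Real.sq_sqrt (by positivity)]; field_simp⟩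
  -- Finitely many balls of radius `h` cover the bounded set `Ω`.
  obtain ⟨t, ht, hcov⟩ := Metric.totallyBounded_iff.1
    (Metric.isCompact_of_isClosed_isBounded isClosed_closure hΩb.closure).totallyBounded h hh
  set C : ℝ := √(2 * volume.real Ω) with hC
  set b : ℝ := volume.real (Metric.ball (0 : EuclideanSpace ℝ (Fin n)) h) with hb
  have hfin : ∀ c, (volume.restrict Ω) (Metric.ball c h) ≠ ⊤ := fun c =>
    ((Measure.restrict_apply_le _ _).trans_lt measure_ball_lt_top).ne
  -- The normalization makes `⟨a c, u⟩ ^ 2` equal to `2 * |Ω|` times the squared mean over the ball.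
  refine ⟨ht.toFinset, fun c => (C * b⁻¹) •
    indicatorConstLp 2 measurableSet_ball (hfin c) (1 : ℝ), fun w => ?_⟩
  obtain ⟨w, hw⟩ := w
  simp only [H10.toL2_apply, Submodule.coe_norm]
  revert w
  refine H10_induction (isClosed_le (by fun_prop) (by fun_prop)) ?_
  rintro w ⟨φ, hφ, hw, hw'⟩
  have hav : ∀ c, inner ℝ ((C * b⁻¹) • indicatorConstLp 2 measurableSet_ball (hfin c) (1 : ℝ))
      (w none) = C * ⨍ y in Metric.ball c h, φ y := by
    intro c
    have h1 : ∫ x in Metric.ball c h, w none x ∂(volume.restrict Ω) =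
        ∫ x in Metric.ball c h, φ x := by
      rw [integral_congr_ae (ae_restrict_of_ae hw), Measure.restrict_restrict measurableSet_ball]
      refine (setIntegral_eq_of_subset_of_forall_sdiff_eq_zero measurableSet_ball
        Set.inter_subset_left fun x hx => ?_).symm
      exact hφ.eq_zero_of_notMem fun hxΩ => hx.2 ⟨hx.1, hxΩ⟩
    rw [real_inner_smul_left, L2.inner_indicatorConstLp_one, h1, setAverage_eq, hb,
      Measure.real, Measure.real, Measure.addHaar_ball_center volume c, smul_eq_mul, mul_assoc]
  have hcov' : Ω ⊆ ⋃ c ∈ ht.toFinset, Metric.ball c h := by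
    simpa using subset_closure.trans hcov
  have hmain := hφ.setIntegral_sq_le hΩo.measurableSet hvol hh hcov'
  rw [hhε] at hmain
  have hgrad : ∑ i, ∫ x in Ω, fderiv ℝ φ x (EuclideanSpace.single i 1) ^ 2 ≤ ‖w‖ ^ 2 := by
    rw [PiLp.norm_sq_eq_of_L2, Fintype.sum_option]
    simp only [norm_sq_eq_of_ae_eq (hw' _)]
    linarith [sq_nonneg ‖w none‖]
  rw [norm_sq_eq_of_ae_eq hw]
  simp only [hav, mul_pow]
  rw [← Finset.mul_sum, hC, Real.sq_sqrt (by positivity)]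
  exact hmain.trans (by gcongr)

/-- Rellich's theorem: the embedding of `H₀¹(Ω)` into `L²(Ω)` is compact. -/
theorem isCompactOperator_toL2 (hΩo : IsOpen Ω) (hΩb : Bornology.IsBounded Ω) :
    IsCompactOperator (H10.toL2 Ω) :=
  isCompactOperator_of_forall_norm_sq_le _ fun _ hε => exists_norm_sq_le_sum_inner_sq hΩo hΩb hε

/-- The operator `(1 - A)⁻¹`, where `A` is the Dirichlet Laplacian, written as `J J†` with the
embedding `J` of `H₀¹(Ω)` into `L²(Ω)`. -/
def dirichletResolvent {n : ℕ} (Ω : Set (EuclideanSpace ℝ (Fin n))) : L2 Ω →L[ℝ] L2 Ω :=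
  H10.toL2 Ω ∘L (H10.toL2 Ω).adjoint

/-- `u = (1 - A)⁻¹ f` lies in the domain of `A`, and `A u = u - f`. -/
theorem isDirichletLaplacian_dirichletResolvent (f : L2 Ω) :
    IsDirichletLaplacian Ω (dirichletResolvent Ω f) (dirichletResolvent Ω f - f) := by
  set u := (H10.toL2 Ω).adjoint f with hu
  refine ⟨(memH10_iff _).2 ⟨u, u.2, rfl⟩, fun φ hφ => ?_⟩
  have hmem : hφ.graph ∈ H10 Ω := subset_closure hφ.graph_mem_testGraph
  have h1 : inner ℝ u ⟨hφ.graph, hmem⟩ = inner ℝ f (hφ.graph none) :=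
    ContinuousLinearMap.adjoint_inner_left _ _ _
  rw [Submodule.coe_inner, PiLp.inner_apply, Fintype.sum_option] at h1
  have h2 : ∀ g : L2 Ω, inner ℝ g (hφ.graph none) = ∫ x in Ω, g x * φ x := fun g =>
    inner_eq_integral_mul_of_ae_eq g hφ.graph_none
  have h3 : ∀ i, inner ℝ ((u : FunctionGradient Ω) (some i)) (hφ.graph (some i)) =
      ∫ x in Ω, (u : FunctionGradient Ω) (some i) x * fderiv ℝ φ x (EuclideanSpace.single i 1) :=
    fun i => inner_eq_integral_mul_of_ae_eq _ (hφ.graph_some i)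
  have h4 : dirichletResolvent Ω f = (u : FunctionGradient Ω) none := rfl
  rw [← h2, h4, integral_mul_laplacian_of_mem_H10 hφ u u.2, inner_sub_left]
  simp only [h3] at h1
  linarith

theorem dirichletResolvent_isSymmetric :
    (dirichletResolvent Ω : L2 Ω →ₗ[ℝ] L2 Ω).IsSymmetric := fun f g => by
  change inner ℝ (H10.toL2 Ω ((H10.toL2 Ω).adjoint f)) g =
    inner ℝ f (H10.toL2 Ω ((H10.toL2 Ω).adjoint g))
  rw [← ContinuousLinearMap.adjoint_inner_right, ContinuousLinearMap.adjoint_inner_left]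

/-- Injectivity of `(1 - A)⁻¹`: if `u = 0`, then `f = u - A u` is orthogonal to all test
functions. -/
theorem eq_zero_of_dirichletResolvent_eq_zero (hΩo : IsOpen Ω) {f : L2 Ω}
    (hf : dirichletResolvent Ω f = 0) :
    f = 0 := by
  have h := (isDirichletLaplacian_dirichletResolvent f).2
  rw [hf, zero_sub] at h
  have hf0 := hΩo.ae_eq_zero_of_integral_contDiff_smul_eq_zero (f := f) (μ := volume)
    (locallyIntegrableOn_of_locallyIntegrable_restrict
      ((Lp.memLp f).locallyIntegrable (by norm_num))) fun φ h1 h2 h3 => ?_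
  · rw [Lp.eq_zero_iff_ae_eq_zero]
    exact (ae_restrict_iff' hΩo.measurableSet).2 hf0
  · have hφ : IsTestFunction Ω φ := ⟨h1, h2, h3⟩
    have h4 := h φ hφ
    have h5 : ∫ x in Ω, (0 : L2 Ω) x * Δ φ x = 0 := by
      rw [integral_congr_ae ((Lp.coeFn_zero ℝ 2 (volume.restrict Ω)).mono fun x hx => by
        rw [hx, Pi.zero_apply, zero_mul])]
      simp
    have h6 : ∫ x in Ω, (-f : L2 Ω) x * φ x = -∫ x in Ω, f x * φ x := by
      rw [← integral_neg]
      exact integral_congr_ae ((Lp.coeFn_neg f).mono fun x hx => by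
        simp only [hx, Pi.neg_apply, neg_mul])
    rw [h5, h6, hφ.setIntegral_mul_eq] at h4
    simp only [smul_eq_mul, mul_comm (φ _)]
    linarith

/-- The Dirichlet eigenfunctions span a dense subspace of `L²(Ω)`. -/
theorem eq_zero_of_forall_inner_eigenfunction_eq_zero (hΩo : IsOpen Ω)
    (hΩb : Bornology.IsBounded Ω) {y : L2 Ω}
    (h : ∀ (μ : ℝ) (e : L2 Ω), IsDirichletLaplacian Ω e (-(μ • e)) → inner ℝ y e = 0) :
    y = 0 := by
  have hcomp : IsCompactOperator (dirichletResolvent Ω) :=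
    (isCompactOperator_toL2 hΩo hΩb).comp_clm (H10.toL2 Ω).adjoint
  have hbot := ContinuousLinearMap.orthogonalComplement_iSup_eigenspaces_eq_bot hcomp
    dirichletResolvent_isSymmetric
  rw [← Submodule.mem_bot ℝ, ← hbot, ← Submodule.iInf_orthogonal, Submodule.mem_iInf]
  intro κ
  rw [Submodule.mem_orthogonal']
  intro e he
  have he' : dirichletResolvent Ω e = κ • e := Module.End.mem_eigenspace_iff.1 he
  by_cases hκ : κ = 0
  · rw [hκ, zero_smul] at he'
    rw [eq_zero_of_dirichletResolvent_eq_zero hΩo he', inner_zero_right]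
  · -- `e = κ⁻¹ (1 - A)⁻¹ e`, hence `A e = e - κ⁻¹ e`.
    refine h (κ⁻¹ - 1) e ?_
    have := (isDirichletLaplacian_dirichletResolvent e).smul κ⁻¹
    rw [he', inv_smul_smul₀ hκ] at this
    convert this using 1
    rw [smul_sub, inv_smul_smul₀ hκ]
    module

end

/-! ### Eigenfunction coefficients of solutions -/

theorem IsScalarSolution.isSolution_smul {n : ℕ} {Ω : Set (EuclideanSpace ℝ (Fin n))} {M : ℝ → ℝ}
    {μ : ℝ} {x : ℝ → ℝ} (hx : IsScalarSolution M μ x) {e : L2 Ω}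
    (he : IsDirichletLaplacian Ω e (-(μ • e))) : IsSolution Ω M e fun t => x t • e where
  continuousOn := hx.continuousOn.smul continuousOn_const
  initial := by rw [hx.initial, one_smul]
  equation v f hv t ht := by
    have hsymm : -(μ * inner ℝ e v) = inner ℝ e f := by
      rw [← he.inner_comm hv, inner_neg_left, real_inner_smul_left]
    simp only [smul_smul, intervalIntegral.integral_smul_const, real_inner_smul_left]
    refine ((hx.equation t ht).mul_const (inner ℝ e v)).congr_deriv ?_
    rw [← hsymm]
    ring

/-- The coefficient of a solution along an eigenfunction, normalized to be `1` at time `0`, solves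
the scalar equation. -/
theorem IsSolution.isScalarSolution_inner_div {n : ℕ} {Ω : Set (EuclideanSpace ℝ (Fin n))}
    {M : ℝ → ℝ} (hM : ContinuousOn M (Set.Ici 0)) {y₀ : L2 Ω} {y : ℝ → L2 Ω}
    (hy : IsSolution Ω M y₀ y) {μ : ℝ} {e : L2 Ω} (he : IsDirichletLaplacian Ω e (-(μ • e)))
    (h0 : inner ℝ y₀ e ≠ 0) :
    IsScalarSolution M μ fun t => inner ℝ (y t) e / inner ℝ y₀ e where
  continuousOn := (hy.continuousOn.inner continuousOn_const).div_const _
  initial := by rw [hy.initial, div_self h0]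
  equation t ht := by
    have hint : IntervalIntegrable (fun s => M (t - s) • y s) volume 0 t := by
      refine ContinuousOn.intervalIntegrable ?_
      rw [Set.uIcc_of_le ht.le]
      refine ContinuousOn.smul (hM.comp (by fun_prop) fun s hs => ?_)
        (hy.continuousOn.mono fun s hs => hs.1)
      simpa using hs.2
    have hI : inner ℝ (∫ s in (0 : ℝ)..t, M (t - s) • y s) e =
        ∫ s in (0 : ℝ)..t, M (t - s) * inner ℝ (y s) e := by
      rw [real_inner_comm]
      refine ((innerSL ℝ e).intervalIntegral_comp_comm hint).symm.trans ?_
      refine intervalIntegral.integral_congr fun s _ => ?_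
      simp [real_inner_comm]
    refine ((hy.equation e _ he t ht).div_const (inner ℝ y₀ e)).congr_deriv ?_
    simp only [hI, inner_neg_right, real_inner_smul_right, ← mul_div_assoc,
      intervalIntegral.integral_div]
    ring

end MemoryHeat

theorem mainTheorem5 (n : ℕ) (hn : 1 ≤ n)
    (Ω : Set (EuclideanSpace ℝ (Fin n))) (hΩ_open : IsOpen Ω) (hΩ_conn : IsConnected Ω)
    (hΩ_bdd : Bornology.IsBounded Ω) (hΩ_C2 : MemoryHeat.HasC2Boundary Ω)
    (M : ℝ → ℝ) (hM : ContDiffOn ℝ 2 M (Set.Ici 0)) :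
    (∀ t₀ : ℝ, 0 < t₀ → MemoryHeat.BackwardUniquenessAt Ω M {t₀}) ↔
      ∀ μ ∈ MemoryHeat.dirichletEigenvalues Ω, ∀ x : ℝ → ℝ,
        MemoryHeat.IsScalarSolution M μ x → {t : ℝ | 0 < t ∧ x t = 0} = ∅ := by
  constructor
  · rintro h μ ⟨e, he0, he⟩ x hx
    refine Set.eq_empty_iff_forall_notMem.2 fun t ht => he0 ?_
    refine h t ht.1 e _ (hx.isSolution_smul he) fun s hs => ?_
    rw [Finset.mem_singleton.1 hs, ht.2, zero_smul]
  · intro h t₀ ht₀ y₀ y hy hyt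
    refine MemoryHeat.eq_zero_of_forall_inner_eigenfunction_eq_zero hΩ_open hΩ_bdd
      fun μ e he => ?_
    by_contra h0
    have hmem : μ ∈ MemoryHeat.dirichletEigenvalues Ω :=
      ⟨e, fun he0 => h0 (by rw [he0, inner_zero_right]), he⟩
    -- The normalized coefficient of `y` along `e` is the scalar solution, and it vanishes at `t₀`.
    have hx := hy.isScalarSolution_inner_div hM.continuousOn he h0
    refine Set.eq_empty_iff_forall_notMem.1 (h μ hmem _ hx) t₀ ⟨ht₀, ?_⟩
    rw [hyt t₀ (Finset.mem_singleton_self t₀), inner_zero_left, zero_div]
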